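/- Let $\Omega\subset\mathbb{R}^n$ be open, $s\in(0,1)$, and let $q:\Omega\to[1,\infty)$ and $p:\Omega\times\Omega\to[1,\infty)$ be Lebesgue measurable with $1<\operatorname{ess\,inf} q$, $\operatorname{ess\,sup} q<\infty$, $1<\operatorname{ess\,inf} p$, $\operatorname{ess\,sup} p<\infty$. Let $L^{q(\cdot)}(\Omega)$ be the set of measurable $u:\Omega\to\mathbb{R}$ with $\int_\Omega|\lambda u(x)|^{q(x)}\,dx<\infty$ for some $\lambda>0$, with norm $\|u\|_{L^{q(\cdot)}(\Omega)}=\inf\{\lambda>0:\int_\Omega|u(x)/\lambda|^{q(x)}\,dx\le1\}$, and define $L^{p(\cdot,\cdot)}(\Omega\times\Omega)$ in the same way. Let $\mathcal{W}^{s,q(\cdot),p(\cdot,\cdot)}(\Omega)$ be the set of $u\in L^{q(\cdot)}(\Omega)$ with $\frac{|u(x)-u(y)|}{|x-y|^{s+n/p(x,y)}}\in L^{p(\cdot,\cdot)}(\Omega\times\Omega)$, with norm $$\|u\|=\|u\|_{L^{q(\cdot)}(\Omega)}+\inf\Big\{\lambda>0:\int_\Omega\int_\Omega\frac{|u(x)-u(y)|^{p(x,y)}}{\lambda^{p(x,y)}|x-y|^{n+sp(x,y)}}\,dx\,dy\le1\Big\}$$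 and modular $$\rho(u)=\int_\Omega|u(x)|^{q(x)}\,dx+\int_\Omega\int_\Omega\frac{|u(x)-u(y)|^{p(x,y)}}{|x-y|^{n+sp(x,y)}}\,dx\,dy .$$ Let $\tilde{\mathcal{W}}^{s,q(\cdot),p(\cdot,\cdot)}(\Omega)$ be the closure in $\mathcal{W}^{s,q(\cdot),p(\cdot,\cdot)}(\Omega)$ of the set of its elements that are (restrictions to $\Omega$ of) continuous functions on $\overline\Omega$ with compact support in $\overline\Omega$. For $O\subset\overline\Omega$ relatively open in $\overline\Omega$ let $$C(O)=\inf\{\rho(u):u\in\tilde{\mathcal{W}}^{s,q(\cdot),p(\cdot,\cdot)}(\Omega),\ u\ge1\text{ a.e. on }O\cap\Omega\}\in[0,\infty]$$ (with $\inf\varnothing=\infty$), and for any $E\subset\overline\Omega$ let $C(E)=\inf\{C(O):O\supset E,\ O\text{ relatively open in }\overline\Omega\}$. A set $P\subset\Omega$ is relatively polar if $C(P)=0$. A function $v:\Omega\to\mathbb{R}$ is relatively quasicontinuous if for every $\varepsilon>0$ there is a relatively open set $O\subset\Omega$ with $C(O)<\varepsilon$ such that the restriction of $v$ to $\Omega\setminus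 O$ is continuous. Theorem. For every $u\in\tilde{\mathcal{W}}^{s,q(\cdot),p(\cdot,\cdot)}(\Omega)$ there is a relatively quasicontinuous function $\tilde u:\Omega\to\mathbb{R}$ with $\tilde u=u$ a.e. in $\Omega$. It is unique up to a relatively polar set: if $v,w:\Omega\to\mathbb{R}$ are relatively quasicontinuous and $v=w=u$ a.e. in $\Omega$, then there is a relatively polar set $P\subset\Omega$ with $v=w$ on $\Omega\setminus P$. -/

import Mathlib

open MeasureTheory
open scoped ENNReal

noncomputable section

namespace FracVarSobolev

/-- The Euclidean space of dimension `n`. -/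
abbrev Euc (n : ℕ) : Type := EuclideanSpace ℝ (Fin n)

/-! Functions on `Ω` are encoded as functions on the whole Euclidean space of which only the values
on `Ω` are used; "measurable" means Lebesgue measurable, i.e. `AEMeasurable` for Lebesgue measure
restricted to `Ω`. -/

section Lebesgue

variable {α : Type*} [MeasureSpace α]

/-- `r` is a variable exponent on `S`: a Lebesgue measurable function `S → [1, ∞)` with
`1 < essinf_S r` and `esssup_S r < ∞`. -/
structure IsVarExponent (S : Set α) (r : α → ℝ) : Prop where
  aemeasurable : AEMeasurable r (volume.restrict S)
  one_le : ∀ x ∈ S, 1 ≤ r x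
  one_lt_essInf : 1 < essInf (fun x => (r x : EReal)) (volume.restrict S)
  essSup_lt_top : essSup (fun x => (r x : EReal)) (volume.restrict S) < ⊤

/-- The modular `∫_S |f(x)|^{r(x)} dx`. -/
def lebModular (S : Set α) (r f : α → ℝ) : ℝ≥0∞ :=
  ∫⁻ x in S, ENNReal.ofReal (|f x| ^ r x)

/-- Membership in the variable exponent Lebesgue space `L^{r(.)}(S)`. -/
def MemVarLp (S : Set α) (r f : α → ℝ) : Prop :=
  AEMeasurable f (volume.restrict S) ∧
    ∃ c : ℝ, 0 < c ∧ lebModular S r (fun x => c * f x) < ∞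

/-- The Luxemburg norm of `L^{r(.)}(S)`. -/
def luxNorm (S : Set α) (r f : α → ℝ) : ℝ≥0∞ :=
  ⨅ (c : ℝ) (_ : 0 < c) (_ : lebModular S r (fun x => f x / c) ≤ 1), ENNReal.ofReal c

end Lebesgue

section Sobolev

variable {n : ℕ}

/-- The quotient `|u(x) - u(y)| / |x - y|^{s + n/p(x,y)}`. -/
def gagliardoQuotient (s : ℝ) (p : Euc n × Euc n → ℝ) (u : Euc n → ℝ) (z : Euc n × Euc n) : ℝ :=
  |u z.1 - u z.2| / ‖z.1 - z.2‖ ^ (s + n / p z)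

/-- Membership in the fractional Sobolev space with variable exponents `W^{s,q(.),p(.,.)}(Ω)`. -/
def MemW (Ω : Set (Euc n)) (s : ℝ) (q : Euc n → ℝ) (p : Euc n × Euc n → ℝ)
    (u : Euc n → ℝ) : Prop :=
  MemVarLp Ω q u ∧ MemVarLp (Ω ×ˢ Ω) p (gagliardoQuotient s p u)

/-- The modular
`∫_Ω |u(x)|^{q(x)} dx + ∫_Ω ∫_Ω |u(x) - u(y)|^{p(x,y)} / |x - y|^{n + s p(x,y)} dx dy`. -/
def sobolevModular (Ω : Set (Euc n)) (s : ℝ) (q : Euc n → ℝ) (p : Euc n × Euc n → ℝ)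
    (u : Euc n → ℝ) : ℝ≥0∞ :=
  lebModular Ω q u +
    ∫⁻ z in Ω ×ˢ Ω, ENNReal.ofReal (|u z.1 - u z.2| ^ p z / ‖z.1 - z.2‖ ^ (n + s * p z))

/-- The variable exponent Gagliardo seminorm. -/
def gagliardoSeminorm (Ω : Set (Euc n)) (s : ℝ) (p : Euc n × Euc n → ℝ)
    (u : Euc n → ℝ) : ℝ≥0∞ :=
  ⨅ (c : ℝ) (_ : 0 < c)
    (_ : ∫⁻ z in Ω ×ˢ Ω,
      ENNReal.ofReal (|u z.1 - u z.2| ^ p z / (c ^ p z * ‖z.1 - z.2‖ ^ (n + s * p z))) ≤ 1),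
    ENNReal.ofReal c

/-- The norm of `W^{s,q(.),p(.,.)}(Ω)`. -/
def sobolevNorm (Ω : Set (Euc n)) (s : ℝ) (q : Euc n → ℝ) (p : Euc n × Euc n → ℝ)
    (u : Euc n → ℝ) : ℝ≥0∞ :=
  luxNorm Ω q u + gagliardoSeminorm Ω s p u

/-- `f` is, on the closure of `Ω`, a continuous function with compact support in the closure
of `Ω`. -/
def MemCcClosure (Ω : Set (Euc n)) (f : Euc n → ℝ) : Prop :=
  ContinuousOn f (closure Ω) ∧
    ∃ K : Set (Euc n), IsCompact K ∧ K ⊆ closure Ω ∧ ∀ x ∈ closure Ω \ K, f x = 0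

/-- Membership in the closure, in the norm of `W^{s,q(.),p(.,.)}(Ω)`, of the set of those elements
of `W^{s,q(.),p(.,.)}(Ω)` that are continuous with compact support on the closure of `Ω`. -/
def MemWTilde (Ω : Set (Euc n)) (s : ℝ) (q : Euc n → ℝ) (p : Euc n × Euc n → ℝ)
    (u : Euc n → ℝ) : Prop :=
  MemW Ω s q p u ∧
    ∀ ε : ℝ, 0 < ε → ∃ f : Euc n → ℝ, MemCcClosure Ω f ∧ MemW Ω s q p f ∧
      sobolevNorm Ω s q p (fun x => u x - f x) < ENNReal.ofReal ε

/-- `O` is a subset of the closure of `Ω` that is open in its relative topology. -/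
def IsRelOpen (Ω O : Set (Euc n)) : Prop :=
  ∃ U : Set (Euc n), IsOpen U ∧ O = closure Ω ∩ U

/-- The relative capacity of a relatively open set `O`: the infimum of the modular over all
`u` in the closure space with `u ≥ 1` a.e. on `O` (that is, on `O ∩ Ω`, `u` being a function
on `Ω`); it is `∞` if there is no such `u`. -/
def relCapOpen (Ω : Set (Euc n)) (s : ℝ) (q : Euc n → ℝ) (p : Euc n × Euc n → ℝ)
    (O : Set (Euc n)) : ℝ≥0∞ :=
  ⨅ (u : Euc n → ℝ) (_ : MemWTilde Ω s q p u)
    (_ : ∀ᵐ x ∂(volume.restrict Ω), x ∈ O → 1 ≤ u x), sobolevModular Ω s q p u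

/-- The relative capacity of an arbitrary subset `E` of the closure of `Ω`. -/
def relCap (Ω : Set (Euc n)) (s : ℝ) (q : Euc n → ℝ) (p : Euc n × Euc n → ℝ)
    (E : Set (Euc n)) : ℝ≥0∞ :=
  ⨅ (O : Set (Euc n)) (_ : IsRelOpen Ω O) (_ : E ⊆ O), relCapOpen Ω s q p O

/-- The two definitions of the capacity agree on relatively open sets. -/
theorem relCap_eq_relCapOpen (Ω : Set (Euc n)) (s : ℝ) (q : Euc n → ℝ) (p : Euc n × Euc n → ℝ)
    {O : Set (Euc n)} (hO : IsRelOpen Ω O) : relCap Ω s q p O = relCapOpen Ω s q p O := by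
  apply le_antisymm
  · exact iInf_le_of_le O (iInf_le_of_le hO (iInf_le_of_le subset_rfl le_rfl))
  · refine le_iInf fun O' => le_iInf fun _ => le_iInf fun h => ?_
    refine le_iInf fun u => le_iInf fun hu => le_iInf fun h1 => ?_
    exact iInf_le_of_le u (iInf_le_of_le hu (iInf_le_of_le
      (h1.mono fun x hx hxO => hx (h hxO)) le_rfl))

/-- A relatively polar subset of `Ω`. -/
def IsRelPolar (Ω : Set (Euc n)) (s : ℝ) (q : Euc n → ℝ) (p : Euc n × Euc n → ℝ)
    (P : Set (Euc n)) : Prop :=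
  P ⊆ Ω ∧ relCap Ω s q p P = 0

/-- `u : Ω → ℝ` is relatively quasicontinuous: for every `ε > 0` there is a relatively open
`O ⊆ Ω` of capacity less than `ε` such that the restriction of `u` to `Ω \ O` is continuous. -/
def IsRelQuasicontinuous (Ω : Set (Euc n)) (s : ℝ) (q : Euc n → ℝ) (p : Euc n × Euc n → ℝ)
    (u : Euc n → ℝ) : Prop :=
  ∀ ε : ℝ, 0 < ε → ∃ O : Set (Euc n), IsRelOpen Ω O ∧ O ⊆ Ω ∧
    relCap Ω s q p O < ENNReal.ofReal ε ∧ ContinuousOn u (Ω \ O)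

end Sobolev

end FracVarSobolev

end

namespace FracVarSobolev

open Filter Topology

/-! ### Modulars with a bounded exponent on a general measure space. -/

section Modular

variable {α : Type*} [MeasureSpace α] {S : Set α} {r f g : α → ℝ} {P : ℝ}

/-! Everything is done with the modular instead of the norm. With exponents in `[1, P]`, smallness
of one is equivalent to smallness of the other (`memWTilde_iff`), and the Sobolev modular is a sum
of two Lebesgue modulars, of `u` and of a quotient linear in `u` (`sobolevModular_eq`).

Existence. Choose continuous `f i` approximating `u` so fast that the modulars of `h i = |4^(i+1) (f
i - f (i+1))|` are summable. Off the open set where some `h (i+m)` exceeds `2^(i+1)`, the shifted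
sequence is uniformly Cauchy, so its limit is continuous there. The series `∑ 2^-(i+1) h (i+m)` is
at least 1 on that set. Its modular is at most the tail `∑ modular (h (i+m))`, because a dyadic
average is bounded by a supremum and the power of a supremum by the sum of the powers
(`ofReal_abs_tsum_rpow_le`). This replaces countable subadditivity of the capacity, with no
accumulating constants.

Uniqueness. Off two small open sets with test functions `g₁`, `g₂`, the set where the
representatives differ is open relative to the remainder and Lebesgue null. Adding it to the two
open sets gives an open set on which `|g₁| + |g₂| ≥ 1` still holds a.e. (`isRelPolar_setOf_ne`). The
absolute values must stay in the closure space (`MemWTilde.abs`), which takes dominated convergence.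
-/

/-- `r` is measurable on `S` with `1 ≤ r ≤ P` almost everywhere. -/
structure BoundedExponent (S : Set α) (r : α → ℝ) (P : ℝ) : Prop where
  one_le_bound : 1 ≤ P
  aemeasurable : AEMeasurable r (volume.restrict S)
  ae_one_le : ∀ᵐ x ∂volume.restrict S, 1 ≤ r x
  ae_le : ∀ᵐ x ∂volume.restrict S, r x ≤ P

theorem BoundedExponent.mono (h : BoundedExponent S r P) {P' : ℝ} (hP : P ≤ P') :
    BoundedExponent S r P' :=
  ⟨h.one_le_bound.trans hP, h.aemeasurable, h.ae_one_le, h.ae_le.mono fun _ hx => hx.trans hP⟩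

theorem IsVarExponent.exists_boundedExponent (hS : MeasurableSet S) (h : IsVarExponent S r) :
    ∃ P, BoundedExponent S r P := by
  -- The maximum with 1 also covers a null `S`, where the essential supremum is `⊥`.
  refine ⟨max 1 (essSup (fun x => (r x : EReal)) (volume.restrict S)).toReal,
    le_max_left _ _, h.aemeasurable, (ae_restrict_mem hS).mono h.one_le, ?_⟩
  filter_upwards [ae_le_essSup (f := fun x => (r x : EReal)) (μ := volume.restrict S)] with x hx
  exact (EReal.coe_le_coe_iff.1 (hx.trans (EReal.le_coe_toReal h.essSup_lt_top.ne))).trans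
    (le_max_right _ _)

theorem aemeasurable_modular_integrand (hr : BoundedExponent S r P)
    (hf : AEMeasurable f (volume.restrict S)) :
    AEMeasurable (fun x => ENNReal.ofReal (|f x| ^ r x)) (volume.restrict S) :=
  ((continuous_abs.measurable.comp_aemeasurable hf).pow hr.aemeasurable).ennreal_ofReal

theorem lebModular_mono (hr : BoundedExponent S r P)
    (h : ∀ᵐ x ∂volume.restrict S, |f x| ≤ |g x|) : lebModular S r f ≤ lebModular S r g := by
  refine lintegral_mono_ae ?_
  filter_upwards [h, hr.ae_one_le] with x hx h1
  gcongr

theorem lebModular_congr_abs (h : ∀ x, |f x| = |g x|) :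
    lebModular S r f = lebModular S r g := by
  simp only [lebModular, h]

theorem ofReal_abs_add_rpow_le {t : ℝ} (h1 : 1 ≤ t) (hP : t ≤ P) (a b : ℝ) :
    ENNReal.ofReal (|a + b| ^ t) ≤
      ENNReal.ofReal (2 ^ P) * (ENNReal.ofReal (|a| ^ t) + ENNReal.ofReal (|b| ^ t)) := by
  rw [← ENNReal.ofReal_add (by positivity) (by positivity), ← ENNReal.ofReal_mul (by positivity)]
  refine ENNReal.ofReal_le_ofReal ?_
  have hab : |a + b| ≤ 2 * max |a| |b| := by
    linarith [abs_add_le a b, le_max_left |a| |b|, le_max_right |a| |b|]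
  calc |a + b| ^ t ≤ (2 * max |a| |b|) ^ t := by gcongr
    _ = 2 ^ t * (max |a| |b|) ^ t := Real.mul_rpow (by norm_num) (by positivity)
    _ ≤ 2 ^ P * (|a| ^ t + |b| ^ t) := by
      gcongr
      · norm_num
      · rcases max_cases |a| |b| with h | h <;> rw [h.1]
        · linarith [Real.rpow_nonneg (abs_nonneg b) t]
        · linarith [Real.rpow_nonneg (abs_nonneg a) t]

theorem lebModular_add_le (hr : BoundedExponent S r P)
    (hf : AEMeasurable f (volume.restrict S)) :
    lebModular S r (fun x => f x + g x) ≤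
      ENNReal.ofReal (2 ^ P) * (lebModular S r f + lebModular S r g) := by
  unfold lebModular
  rw [← lintegral_add_left' (aemeasurable_modular_integrand hr hf),
    ← lintegral_const_mul' _ _ ENNReal.ofReal_ne_top]
  refine lintegral_mono_ae ?_
  filter_upwards [hr.ae_one_le, hr.ae_le] with x h1 hP
  exact ofReal_abs_add_rpow_le h1 hP _ _

theorem lebModular_const_mul_le (hr : BoundedExponent S r P) (c : ℝ) (f : α → ℝ) :
    lebModular S r (fun x => c * f x) ≤
      ENNReal.ofReal ((max 1 |c|) ^ P) * lebModular S r f := by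
  unfold lebModular
  rw [← lintegral_const_mul' _ _ ENNReal.ofReal_ne_top]
  refine lintegral_mono_ae ?_
  filter_upwards [hr.ae_one_le, hr.ae_le] with x h1 hP
  rw [← ENNReal.ofReal_mul (by positivity), abs_mul, Real.mul_rpow (by positivity) (by positivity)]
  have : |c| ^ r x ≤ (max 1 |c|) ^ P :=
    (Real.rpow_le_rpow (abs_nonneg c) (le_max_right 1 _) (by linarith)).trans
      (Real.rpow_le_rpow_of_exponent_le (le_max_left _ _) hP)
  gcongr

/-- Since `c ≤ 1` and the exponent is at least 1, `c ^ r x ≤ c`; no upper bound of the exponent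
enters the constant. -/
theorem lebModular_const_mul_le_of_le_one (hr : BoundedExponent S r P) {c : ℝ} (h0 : 0 ≤ c)
    (hc : c ≤ 1) (f : α → ℝ) :
    lebModular S r (fun x => c * f x) ≤ ENNReal.ofReal c * lebModular S r f := by
  unfold lebModular
  rw [← lintegral_const_mul' _ _ ENNReal.ofReal_ne_top]
  refine lintegral_mono_ae ?_
  filter_upwards [hr.ae_one_le] with x h1
  rw [← ENNReal.ofReal_mul h0, abs_mul, abs_of_nonneg h0, Real.mul_rpow h0 (abs_nonneg _)]
  have : c ^ r x ≤ c := by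
    rcases h0.eq_or_lt with rfl | h0
    · rw [Real.zero_rpow (by linarith)]
    · simpa using Real.rpow_le_rpow_of_exponent_ge h0 hc h1
  gcongr

theorem memVarLp_iff (hr : BoundedExponent S r P) :
    MemVarLp S r f ↔ AEMeasurable f (volume.restrict S) ∧ lebModular S r f < ∞ := by
  refine and_congr_right fun _ => ⟨?_, fun h => ⟨1, one_pos, by simpa using h⟩⟩
  rintro ⟨c, hc, h⟩
  have := lebModular_const_mul_le hr c⁻¹ (fun x => c * f x)
  simp only [inv_mul_cancel_left₀ hc.ne'] at this
  exact this.trans_lt (ENNReal.mul_lt_top ENNReal.ofReal_lt_top h)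

theorem lebModular_lt_of_luxNorm_lt (hr : BoundedExponent S r P) {ε : ℝ} (hε : ε ≤ 1)
    (h : luxNorm S r f < ENNReal.ofReal ε) : lebModular S r f < ENNReal.ofReal ε := by
  simp only [luxNorm, iInf_lt_iff] at h
  obtain ⟨c, hc, h1, hlt⟩ := h
  have hcε : c < ε := (ENNReal.ofReal_lt_ofReal_iff_of_nonneg hc.le).1 hlt
  have := lebModular_const_mul_le_of_le_one hr hc.le (hcε.le.trans hε) (fun x => f x / c)
  simp only [mul_div_cancel₀ _ hc.ne'] at this
  calc _ ≤ _ := this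
    _ ≤ ENNReal.ofReal c * 1 := by gcongr
    _ < _ := by simpa using hlt

/-- Dividing by `c ≤ 1` enlarges the modular by at most `c⁻¹ ^ P`, the worst case over the
exponents. -/
theorem luxNorm_le_of_lebModular_le (hr : BoundedExponent S r P) {c : ℝ} (hc : 0 < c)
    (hc1 : c ≤ 1) (h : lebModular S r f ≤ ENNReal.ofReal (c ^ P)) :
    luxNorm S r f ≤ ENNReal.ofReal c := by
  refine iInf_le_of_le c (iInf_le_of_le hc (iInf_le_of_le ?_ le_rfl))
  have := lebModular_const_mul_le hr c⁻¹ f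
  rw [abs_of_pos (by positivity), max_eq_right ((one_le_inv₀ hc).2 hc1)] at this
  calc lebModular S r (fun x => f x / c) = lebModular S r (fun x => c⁻¹ * f x) := by
        simp only [div_eq_inv_mul]
    _ ≤ _ := this
    _ ≤ ENNReal.ofReal (c⁻¹ ^ P) * ENNReal.ofReal (c ^ P) := by gcongr
    _ = 1 := by
      rw [← ENNReal.ofReal_mul (by positivity), ← Real.mul_rpow (by positivity) hc.le,
        inv_mul_cancel₀ hc.ne', Real.one_rpow, ENNReal.ofReal_one]

/-- A dyadic average of reals is at most their supremum; here for powers in place of suprema. -/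
theorem ofReal_abs_tsum_rpow_le {t : ℝ} (ht : 1 ≤ t) (h : ℕ → ℝ) :
    ENNReal.ofReal (|∑' i, (1 / 2 : ℝ) ^ (i + 1) * h i| ^ t) ≤
      ∑' i, ENNReal.ofReal (|h i| ^ t) := by
  set A := ∑' i, ENNReal.ofReal (|h i| ^ t) with hA
  -- If `A = ∞` the real series may diverge and `tsum` take its default value, but the bound is
  -- trivial.
  by_cases hT : A = ∞
  · simp [hT]
  have hb : ∀ i, |h i| ≤ A.toReal ^ (1 / t) := fun i => by
    have h1 : |h i| ^ t ≤ A.toReal :=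
      (ENNReal.ofReal_le_iff_le_toReal hT).1 (ENNReal.le_tsum (f := fun i => ENNReal.ofReal (|h i| ^ t)) i)
    rw [one_div]
    exact (Real.le_rpow_inv_iff_of_pos (abs_nonneg _) ENNReal.toReal_nonneg (by linarith)).2 h1
  have hg : HasSum (fun i : ℕ => (1 / 2 : ℝ) ^ (i + 1) * A.toReal ^ (1 / t))
      (A.toReal ^ (1 / t)) := by
    have := (hasSum_geometric_two' (1 : ℝ)).mul_right (A.toReal ^ (1 / t))
    rw [one_mul] at this
    have he : ∀ i : ℕ, (1 / 2 : ℝ) ^ (i + 1) = 1 / 2 / 2 ^ i := fun i => by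
      rw [pow_succ, one_div_pow]
      ring
    simpa only [he] using this
  have hs : |∑' i, (1 / 2 : ℝ) ^ (i + 1) * h i| ≤ A.toReal ^ (1 / t) := by
    refine (Real.norm_eq_abs _).symm.trans_le (tsum_of_norm_bounded hg fun i => ?_)
    rw [norm_mul, Real.norm_eq_abs, Real.norm_eq_abs, abs_of_pos (by positivity)]
    have := hb i
    gcongr
  rw [ENNReal.ofReal_le_iff_le_toReal hT]
  calc _ ≤ (A.toReal ^ (1 / t)) ^ t := by gcongr
    _ = A.toReal := by
      rw [← Real.rpow_mul ENNReal.toReal_nonneg, one_div_mul_cancel (by linarith), Real.rpow_one]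

/-- Needed wherever series are subtracted or split, since there the default value of `tsum` would do
harm. -/
theorem summable_dyadic_of_tsum_rpow_ne_top {t : ℝ} (ht : 1 ≤ t) {h : ℕ → ℝ}
    (hT : ∑' i, ENNReal.ofReal (|h i| ^ t) ≠ ∞) :
    Summable fun i => (1 / 2 : ℝ) ^ (i + 1) * h i := by
  set A := ∑' i, ENNReal.ofReal (|h i| ^ t) with hA
  have hb : ∀ i, |h i| ≤ A.toReal ^ t⁻¹ := fun i =>
    (Real.le_rpow_inv_iff_of_pos (abs_nonneg _) ENNReal.toReal_nonneg (by linarith)).2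
      ((ENNReal.ofReal_le_iff_le_toReal hT).1
        (ENNReal.le_tsum (f := fun i => ENNReal.ofReal (|h i| ^ t)) i))
  have hg : Summable fun i : ℕ => (1 / 2 : ℝ) ^ (i + 1) * A.toReal ^ t⁻¹ :=
    ((summable_nat_add_iff 1).2 summable_geometric_two).mul_right _
  refine hg.of_norm_bounded fun i => ?_
  rw [norm_mul, Real.norm_eq_abs, Real.norm_eq_abs, abs_of_pos (by positivity)]
  have := hb i
  gcongr

theorem tsum_lebModular (hr : BoundedExponent S r P) {h : ℕ → α → ℝ}
    (hm : ∀ i, AEMeasurable (h i) (volume.restrict S)) :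
    ∫⁻ x in S, ∑' i, ENNReal.ofReal (|h i x| ^ r x) = ∑' i, lebModular S r (h i) :=
  lintegral_tsum fun i => aemeasurable_modular_integrand hr (hm i)

theorem ae_tsum_ne_top (hr : BoundedExponent S r P) {h : ℕ → α → ℝ}
    (hm : ∀ i, AEMeasurable (h i) (volume.restrict S))
    (hT : ∑' i, lebModular S r (h i) ≠ ∞) :
    ∀ᵐ x ∂volume.restrict S, ∑' i, ENNReal.ofReal (|h i x| ^ r x) ≠ ∞ := by
  refine (ae_lt_top' (AEMeasurable.tsum fun i =>
    aemeasurable_modular_integrand hr (hm i)) ?_).mono fun x hx => hx.ne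
  rwa [tsum_lebModular hr hm]

theorem lebModular_tsum_le (hr : BoundedExponent S r P) {h : ℕ → α → ℝ}
    (hm : ∀ i, AEMeasurable (h i) (volume.restrict S)) :
    lebModular S r (fun x => ∑' i, (1 / 2 : ℝ) ^ (i + 1) * h i x) ≤
      ∑' i, lebModular S r (h i) := by
  rw [← tsum_lebModular hr hm]
  refine lintegral_mono_ae ?_
  filter_upwards [hr.ae_one_le] with x h1
  exact ofReal_abs_tsum_rpow_le h1 _

theorem ae_tendsto_zero_of_tsum_lebModular (hr : BoundedExponent S r P) {h : ℕ → α → ℝ}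
    (hm : ∀ i, AEMeasurable (h i) (volume.restrict S))
    (hT : ∑' i, lebModular S r (h i) ≠ ∞) :
    ∀ᵐ x ∂volume.restrict S, Tendsto (fun i => h i x) atTop (𝓝 0) := by
  filter_upwards [ae_tsum_ne_top hr hm hT, hr.ae_one_le] with x hx h1
  have h2 := (ENNReal.tendsto_toReal ENNReal.zero_ne_top).comp
    (ENNReal.tendsto_atTop_zero_of_tsum_ne_top hx)
  have h3 := h2.rpow_const (p := (r x)⁻¹) (Or.inr (by positivity))
  rw [ENNReal.toReal_zero, Real.zero_rpow (by positivity)] at h3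
  refine squeeze_zero_norm (fun i => le_of_eq ?_) h3
  simp only [Function.comp_apply]
  rw [ENNReal.toReal_ofReal (by positivity), Real.rpow_rpow_inv (abs_nonneg _) (by positivity)]
  rfl

end Modular

/-! ### The Sobolev modular as a sum of two Lebesgue modulars. -/

section Sobolev

variable {n : ℕ} {Ω : Set (Euc n)} {s : ℝ} {q : Euc n → ℝ} {p : Euc n × Euc n → ℝ} {P : ℝ}
  {u v : Euc n → ℝ}

/-- The quotient `(u(x) - u(y)) / |x - y|^{s + n/p(x,y)}`, which is linear in `u`. -/
noncomputable def signedQuotient (s : ℝ) (p : Euc n × Euc n → ℝ) (u : Euc n → ℝ) (z : Euc n × Euc n) : ℝ :=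
  (u z.1 - u z.2) / ‖z.1 - z.2‖ ^ (s + n / p z)

theorem abs_signedQuotient (u : Euc n → ℝ) (z : Euc n × Euc n) :
    |signedQuotient s p u z| = |gagliardoQuotient s p u z| := by
  simp only [signedQuotient, gagliardoQuotient, abs_div, abs_abs]

theorem signedQuotient_add (u v : Euc n → ℝ) :
    signedQuotient s p (fun x => u x + v x) =
      fun z => signedQuotient s p u z + signedQuotient s p v z := by
  ext z
  simp only [signedQuotient]
  ring

theorem signedQuotient_const_mul (c : ℝ) (u : Euc n → ℝ) :
    signedQuotient s p (fun x => c * u x) = fun z => c * signedQuotient s p u z := by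
  ext z
  simp only [signedQuotient]
  ring

/-- The kernel and the quotient match because `(s + n / t) * t = s * t + n`. -/
theorem abs_rpow_div_eq {t : ℝ} (ht : 1 ≤ t) {c : ℝ} (hc : 0 ≤ c) (a d : ℝ) (hd : 0 ≤ d) :
    |a| ^ t / (c ^ t * d ^ (n + s * t)) = |a / d ^ (s + n / t) / c| ^ t := by
  have ht0 : t ≠ 0 := by linarith
  rw [abs_div, abs_div, abs_of_nonneg hc, abs_of_nonneg (Real.rpow_nonneg hd _),
    Real.div_rpow (by positivity) hc, Real.div_rpow (abs_nonneg _) (by positivity),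
    ← Real.rpow_mul hd, add_mul, div_mul_cancel₀ _ ht0, div_div, mul_comm (c ^ t), add_comm (n : ℝ)]

theorem sobolevModular_eq (hp : BoundedExponent (Ω ×ˢ Ω) p P) (q u) :
    sobolevModular Ω s q p u =
      lebModular Ω q u + lebModular (Ω ×ˢ Ω) p (signedQuotient s p u) := by
  unfold sobolevModular
  congr 1
  refine lintegral_congr_ae ?_
  filter_upwards [hp.ae_one_le] with z hz
  have := abs_rpow_div_eq (n := n) (s := s) hz zero_le_one (u z.1 - u z.2) ‖z.1 - z.2‖
    (norm_nonneg _)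
  rw [Real.one_rpow, one_mul, div_one] at this
  rw [this, signedQuotient]

theorem gagliardoSeminorm_eq (hp : BoundedExponent (Ω ×ˢ Ω) p P) (u : Euc n → ℝ) :
    gagliardoSeminorm Ω s p u = luxNorm (Ω ×ˢ Ω) p (signedQuotient s p u) := by
  unfold gagliardoSeminorm luxNorm
  refine iInf_congr fun c => iInf_congr fun hc => ?_
  have : ∫⁻ z in Ω ×ˢ Ω,
      ENNReal.ofReal (|u z.1 - u z.2| ^ p z / (c ^ p z * ‖z.1 - z.2‖ ^ (n + s * p z))) =
      lebModular (Ω ×ˢ Ω) p (fun z => signedQuotient s p u z / c) := by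
    refine lintegral_congr_ae ?_
    filter_upwards [hp.ae_one_le] with z hz
    rw [abs_rpow_div_eq hz hc.le _ _ (norm_nonneg _), signedQuotient]
  rw [this]

theorem ae_prod_of_ae {Q : Euc n → Prop} (h : ∀ᵐ x ∂volume.restrict Ω, Q x) :
    ∀ᵐ z ∂volume.restrict (Ω ×ˢ Ω), Q z.1 ∧ Q z.2 := by
  rw [Measure.volume_eq_prod, ← Measure.prod_restrict]
  exact (Measure.quasiMeasurePreserving_fst.ae h).and (Measure.quasiMeasurePreserving_snd.ae h)

theorem aemeasurable_signedQuotient (hp : BoundedExponent (Ω ×ˢ Ω) p P)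
    (hu : AEMeasurable u (volume.restrict Ω)) :
    AEMeasurable (signedQuotient s p u) (volume.restrict (Ω ×ˢ Ω)) := by
  have hm : AEMeasurable (fun z : Euc n × Euc n => u z.1 - u z.2)
      (volume.restrict (Ω ×ˢ Ω)) := by
    rw [Measure.volume_eq_prod, ← Measure.prod_restrict]
    exact hu.comp_fst.sub hu.comp_snd
  have hd : AEMeasurable (fun z : Euc n × Euc n => ‖z.1 - z.2‖) (volume.restrict (Ω ×ˢ Ω)) :=
    (continuous_fst.sub continuous_snd).norm.aemeasurable
  exact hm.div (hd.pow ((hp.aemeasurable.const_div _).const_add _))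

theorem aemeasurable_gagliardoQuotient (hp : BoundedExponent (Ω ×ˢ Ω) p P)
    (hu : AEMeasurable u (volume.restrict Ω)) :
    AEMeasurable (gagliardoQuotient s p u) (volume.restrict (Ω ×ˢ Ω)) := by
  have h := (continuous_abs.measurable.comp_aemeasurable
    (aemeasurable_signedQuotient (s := s) hp hu))
  refine h.congr (Eventually.of_forall fun z => ?_)
  simp only [Function.comp_apply, signedQuotient, gagliardoQuotient, abs_div]
  rw [abs_of_nonneg (Real.rpow_nonneg (norm_nonneg _) _)]

theorem memW_iff (hq : BoundedExponent Ω q P) (hp : BoundedExponent (Ω ×ˢ Ω) p P) :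
    MemW Ω s q p u ↔ AEMeasurable u (volume.restrict Ω) ∧ sobolevModular Ω s q p u < ∞ := by
  rw [MemW, memVarLp_iff hq, memVarLp_iff hp, sobolevModular_eq hp,
    ← lebModular_congr_abs (abs_signedQuotient u), ENNReal.add_lt_top]
  constructor
  · rintro ⟨⟨h1, h2⟩, -, h3⟩
    exact ⟨h1, h2, h3⟩
  · rintro ⟨h1, h2, h3⟩
    exact ⟨⟨h1, h2⟩, aemeasurable_gagliardoQuotient hp h1, h3⟩

theorem sobolevModular_lt_of_sobolevNorm_lt (hq : BoundedExponent Ω q P)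
    (hp : BoundedExponent (Ω ×ˢ Ω) p P) {ε : ℝ} (h0 : 0 ≤ ε) (hε : ε ≤ 1)
    (h : sobolevNorm Ω s q p u < ENNReal.ofReal ε) :
    sobolevModular Ω s q p u < ENNReal.ofReal (2 * ε) := by
  rw [sobolevNorm, gagliardoSeminorm_eq hp] at h
  rw [sobolevModular_eq hp, two_mul, ENNReal.ofReal_add h0 h0]
  exact ENNReal.add_lt_add
    (lebModular_lt_of_luxNorm_lt hq hε (le_self_add.trans_lt h))
    (lebModular_lt_of_luxNorm_lt hp hε (le_add_self.trans_lt h))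

theorem sobolevNorm_le_of_sobolevModular_le (hq : BoundedExponent Ω q P)
    (hp : BoundedExponent (Ω ×ˢ Ω) p P) {c : ℝ} (hc : 0 < c) (hc1 : c ≤ 1)
    (h : sobolevModular Ω s q p u ≤ ENNReal.ofReal (c ^ P)) :
    sobolevNorm Ω s q p u ≤ ENNReal.ofReal (2 * c) := by
  rw [sobolevModular_eq hp] at h
  rw [sobolevNorm, gagliardoSeminorm_eq hp, two_mul, ENNReal.ofReal_add hc.le hc.le]
  exact add_le_add (luxNorm_le_of_lebModular_le hq hc hc1 (le_self_add.trans h))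
    (luxNorm_le_of_lebModular_le hp hc hc1 (le_add_self.trans h))

/-- Norm approximation and approximation in the modular are equivalent. -/
theorem memWTilde_iff (hq : BoundedExponent Ω q P) (hp : BoundedExponent (Ω ×ˢ Ω) p P) :
    MemWTilde Ω s q p u ↔ MemW Ω s q p u ∧
      ∀ ε : ℝ≥0∞, ε ≠ 0 → ∃ f : Euc n → ℝ, MemCcClosure Ω f ∧ MemW Ω s q p f ∧
        sobolevModular Ω s q p (fun x => u x - f x) < ε := by
  refine and_congr_right fun _ => ⟨fun h ε hε => ?_, fun h ε hε => ?_⟩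
  · obtain ⟨δ, hδ, hδε⟩ : ∃ δ : ℝ, 0 < δ ∧ ENNReal.ofReal δ ≤ ε := by
      rcases eq_or_ne ε ∞ with rfl | hT
      · exact ⟨1, one_pos, le_top⟩
      · exact ⟨ε.toReal, ENNReal.toReal_pos hε hT, (ENNReal.ofReal_toReal hT).le⟩
    obtain ⟨f, hf, hfW, hfu⟩ := h (min 1 (δ / 2)) (by positivity)
    refine ⟨f, hf, hfW, (sobolevModular_lt_of_sobolevNorm_lt hq hp (by positivity)
      (min_le_left _ _) hfu).trans_le (le_trans (ENNReal.ofReal_le_ofReal ?_) hδε)⟩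
    linarith [min_le_right 1 (δ / 2)]
  -- The norm is then at most `2 * (ε / 4)`, which is strictly below `ε`.
  · have hc : 0 < min 1 (ε / 4) := by positivity
    obtain ⟨f, hf, hfW, hfu⟩ := h (ENNReal.ofReal (min 1 (ε / 4) ^ P))
      (ENNReal.ofReal_pos.2 (by positivity)).ne'
    refine ⟨f, hf, hfW, (sobolevNorm_le_of_sobolevModular_le hq hp hc (min_le_left _ _)
      hfu.le).trans_lt ((ENNReal.ofReal_lt_ofReal_iff hε).2 ?_)⟩
    linarith [min_le_right 1 (ε / 4)]

/-! ### Stability under sums, multiples and contractions; fast approximation. -/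

theorem sobolevModular_add_le (hq : BoundedExponent Ω q P) (hp : BoundedExponent (Ω ×ˢ Ω) p P)
    (hu : AEMeasurable u (volume.restrict Ω)) :
    sobolevModular Ω s q p (fun x => u x + v x) ≤
      ENNReal.ofReal (2 ^ P) * (sobolevModular Ω s q p u + sobolevModular Ω s q p v) := by
  simp only [sobolevModular_eq hp, signedQuotient_add]
  refine (add_le_add (lebModular_add_le hq hu)
    (lebModular_add_le hp (aemeasurable_signedQuotient hp hu))).trans_eq ?_
  ring

theorem sobolevModular_const_mul_le (hq : BoundedExponent Ω q P)
    (hp : BoundedExponent (Ω ×ˢ Ω) p P) (c : ℝ) (u : Euc n → ℝ) :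
    sobolevModular Ω s q p (fun x => c * u x) ≤
      ENNReal.ofReal ((max 1 |c|) ^ P) * sobolevModular Ω s q p u := by
  simp only [sobolevModular_eq hp, signedQuotient_const_mul]
  rw [mul_add]
  exact add_le_add (lebModular_const_mul_le hq c u) (lebModular_const_mul_le hp c _)

/-- The modular does not increase under contractions. -/
theorem sobolevModular_mono (hq : BoundedExponent Ω q P) (hp : BoundedExponent (Ω ×ˢ Ω) p P)
    (h : ∀ x, |u x| ≤ |v x|) (h' : ∀ x y, |u x - u y| ≤ |v x - v y|) :
    sobolevModular Ω s q p u ≤ sobolevModular Ω s q p v := by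
  simp only [sobolevModular_eq hp]
  refine add_le_add (lebModular_mono hq (Eventually.of_forall h))
    (lebModular_mono hp (Eventually.of_forall fun z => ?_))
  simp only [signedQuotient, abs_div]
  have := h' z.1 z.2
  gcongr

theorem sobolevModular_abs_le (hq : BoundedExponent Ω q P) (hp : BoundedExponent (Ω ×ˢ Ω) p P)
    (u : Euc n → ℝ) :
    sobolevModular Ω s q p (fun x => |u x|) ≤ sobolevModular Ω s q p u :=
  sobolevModular_mono hq hp (fun _ => (abs_abs _).le) fun _ _ => abs_abs_sub_abs_le _ _

theorem sobolevModular_zero (hp : BoundedExponent (Ω ×ˢ Ω) p P) (hq : BoundedExponent Ω q P) :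
    sobolevModular Ω s q p (fun _ => 0) = 0 := by
  rw [sobolevModular_eq hp, add_eq_zero]
  constructor
  · refine (lintegral_congr_ae ?_).trans lintegral_zero
    filter_upwards [hq.ae_one_le] with x hx
    simp [Real.zero_rpow (show q x ≠ 0 by linarith)]
  · refine (lintegral_congr_ae ?_).trans lintegral_zero
    filter_upwards [hp.ae_one_le] with x hx
    simp [signedQuotient, Real.zero_rpow (show p x ≠ 0 by linarith)]

theorem MemW.add (hq : BoundedExponent Ω q P) (hp : BoundedExponent (Ω ×ˢ Ω) p P)
    (hu : MemW Ω s q p u) (hv : MemW Ω s q p v) : MemW Ω s q p (fun x => u x + v x) := by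
  rw [memW_iff hq hp] at *
  exact ⟨hu.1.add hv.1, (sobolevModular_add_le hq hp hu.1).trans_lt
    (ENNReal.mul_lt_top ENNReal.ofReal_lt_top (ENNReal.add_lt_top.2 ⟨hu.2, hv.2⟩))⟩

theorem MemW.const_mul (hq : BoundedExponent Ω q P) (hp : BoundedExponent (Ω ×ˢ Ω) p P)
    (c : ℝ) (hu : MemW Ω s q p u) : MemW Ω s q p (fun x => c * u x) := by
  rw [memW_iff hq hp] at *
  exact ⟨hu.1.const_mul c, (sobolevModular_const_mul_le hq hp c u).trans_lt
    (ENNReal.mul_lt_top ENNReal.ofReal_lt_top hu.2)⟩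

theorem MemW.sub (hq : BoundedExponent Ω q P) (hp : BoundedExponent (Ω ×ˢ Ω) p P)
    (hu : MemW Ω s q p u) (hv : MemW Ω s q p v) : MemW Ω s q p (fun x => u x - v x) := by
  have := hu.add hq hp (hv.const_mul hq hp (-1))
  simpa only [neg_one_mul, ← sub_eq_add_neg] using this

theorem MemW.abs (hq : BoundedExponent Ω q P) (hp : BoundedExponent (Ω ×ˢ Ω) p P)
    (hu : MemW Ω s q p u) : MemW Ω s q p (fun x => |u x|) := by
  rw [memW_iff hq hp] at *
  exact ⟨continuous_abs.measurable.comp_aemeasurable hu.1,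
    (sobolevModular_abs_le hq hp u).trans_lt hu.2⟩

theorem MemCcClosure.add (hu : MemCcClosure Ω u) (hv : MemCcClosure Ω v) :
    MemCcClosure Ω (fun x => u x + v x) := by
  obtain ⟨hu, K, hK, hKΩ, hK0⟩ := hu
  obtain ⟨hv, L, hL, hLΩ, hL0⟩ := hv
  refine ⟨hu.add hv, K ∪ L, hK.union hL, Set.union_subset hKΩ hLΩ, fun x hx => ?_⟩
  have h := not_or.1 hx.2
  simp [hK0 x ⟨hx.1, h.1⟩, hL0 x ⟨hx.1, h.2⟩]

theorem MemCcClosure.comp {φ : ℝ → ℝ} (hφ : Continuous φ) (h0 : φ 0 = 0)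
    (hu : MemCcClosure Ω u) : MemCcClosure Ω (fun x => φ (u x)) := by
  obtain ⟨hu, K, hK, hKΩ, hK0⟩ := hu
  exact ⟨hφ.comp_continuousOn hu, K, hK, hKΩ, fun x hx => by simp [hK0 x hx, h0]⟩

theorem MemCcClosure.sub (hu : MemCcClosure Ω u) (hv : MemCcClosure Ω v) :
    MemCcClosure Ω (fun x => u x - v x) := by
  simpa only [← sub_eq_add_neg] using hu.add (hv.comp continuous_neg neg_zero)

theorem MemWTilde.add (hq : BoundedExponent Ω q P) (hp : BoundedExponent (Ω ×ˢ Ω) p P)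
    (hu : MemWTilde Ω s q p u) (hv : MemWTilde Ω s q p v) :
    MemWTilde Ω s q p (fun x => u x + v x) := by
  rw [memWTilde_iff hq hp] at *
  refine ⟨hu.1.add hq hp hv.1, fun ε hε => ?_⟩
  have hK : ENNReal.ofReal (2 ^ P) ≠ 0 := (ENNReal.ofReal_pos.2 (by positivity)).ne'
  have hδ : ε / ENNReal.ofReal (2 ^ P) / 2 ≠ 0 :=
    (ENNReal.half_pos (ENNReal.div_pos hε ENNReal.ofReal_ne_top).ne').ne'
  obtain ⟨f, hf, hfW, hfu⟩ := hu.2 _ hδ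
  obtain ⟨g, hg, hgW, hgv⟩ := hv.2 _ hδ
  refine ⟨_, hf.add hg, hfW.add hq hp hgW, ?_⟩
  simp only [add_sub_add_comm]
  refine (sobolevModular_add_le hq hp
    ((memW_iff hq hp).1 (hu.1.sub hq hp hfW)).1).trans_lt ?_
  calc _ < ENNReal.ofReal (2 ^ P) *
        (ε / ENNReal.ofReal (2 ^ P) / 2 + ε / ENNReal.ofReal (2 ^ P) / 2) :=
        (ENNReal.mul_lt_mul_iff_right hK ENNReal.ofReal_ne_top).2 (ENNReal.add_lt_add hfu hgv)
    _ = ε := by rw [ENNReal.add_halves, ENNReal.mul_div_cancel hK ENNReal.ofReal_ne_top]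

/-- Fast approximation: the scaled errors have geometrically small modular. -/
theorem MemWTilde.exists_seq (hq : BoundedExponent Ω q P) (hp : BoundedExponent (Ω ×ˢ Ω) p P)
    (hu : MemWTilde Ω s q p u) :
    ∃ f : ℕ → Euc n → ℝ, (∀ i, MemCcClosure Ω (f i)) ∧ (∀ i, MemW Ω s q p (f i)) ∧
      ∀ i, sobolevModular Ω s q p (fun x => (4 : ℝ) ^ (i + 1) * (u x - f i x)) ≤
        (2⁻¹ : ℝ≥0∞) ^ i := by
  have H : ∀ i : ℕ, ∃ f : Euc n → ℝ, MemCcClosure Ω f ∧ MemW Ω s q p f ∧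
      sobolevModular Ω s q p (fun x => (4 : ℝ) ^ (i + 1) * (u x - f x)) ≤
        (2⁻¹ : ℝ≥0∞) ^ i := fun i => by
    set K := ENNReal.ofReal ((max 1 |(4 : ℝ) ^ (i + 1)|) ^ P) with hKdef
    have hK : K ≠ 0 := (ENNReal.ofReal_pos.2 (by positivity)).ne'
    have hK' : K ≠ ∞ := ENNReal.ofReal_ne_top
    obtain ⟨f, hf, hfW, hfu⟩ := ((memWTilde_iff hq hp).1 hu).2 ((2⁻¹ : ℝ≥0∞) ^ i / K)
      (ENNReal.div_pos (pow_ne_zero _ (by simp)) hK').ne'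
    refine ⟨f, hf, hfW, (sobolevModular_const_mul_le hq hp _ _).trans ?_⟩
    calc _ ≤ K * ((2⁻¹ : ℝ≥0∞) ^ i / K) := by gcongr
      _ = _ := ENNReal.mul_div_cancel hK hK'
  choose f h1 h2 h3 using H
  exact ⟨f, h1, h2, h3⟩

theorem tsum_inv_two_pow_ne_top : ∑' i : ℕ, (2⁻¹ : ℝ≥0∞) ^ i ≠ ∞ := by
  rw [ENNReal.tsum_geometric]
  simp

theorem lebModular_le_sobolevModular : lebModular Ω q u ≤ sobolevModular Ω s q p u :=
  le_self_add

theorem sobolevModular_le_const_mul (hq : BoundedExponent Ω q P)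
    (hp : BoundedExponent (Ω ×ˢ Ω) p P) {c : ℝ} (hc : 1 ≤ c) (u : Euc n → ℝ) :
    sobolevModular Ω s q p u ≤ sobolevModular Ω s q p (fun x => c * u x) := by
  have hc0 : |c| = c := abs_of_nonneg (by linarith)
  refine sobolevModular_mono hq hp (fun x => ?_) fun x y => ?_
  · rw [abs_mul, hc0]
    exact le_mul_of_one_le_left (abs_nonneg _) hc
  · rw [← mul_sub, abs_mul, hc0]
    exact le_mul_of_one_le_left (abs_nonneg _) hc

/-! ### Absolute values in the closure space. -/

theorem ae_tendsto_of_tsum_sobolevModular (hq : BoundedExponent Ω q P)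
    {f : ℕ → Euc n → ℝ} (hu : AEMeasurable u (volume.restrict Ω))
    (hf : ∀ i, AEMeasurable (f i) (volume.restrict Ω))
    (hT : ∑' i, sobolevModular Ω s q p (fun x => u x - f i x) ≠ ∞) :
    ∀ᵐ x ∂volume.restrict Ω, Tendsto (fun i => f i x) atTop (𝓝 (u x)) := by
  have hT' : ∑' i, lebModular Ω q (fun x => u x - f i x) ≠ ∞ :=
    ne_top_of_le_ne_top hT (ENNReal.tsum_le_tsum fun i => lebModular_le_sobolevModular)
  filter_upwards [ae_tendsto_zero_of_tsum_lebModular hq (fun i => hu.sub (hf i)) hT'] with x hx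
  simpa using hx.const_sub (u x)

/-- The Gagliardo part of `|u| - |f i|` is not controlled pointwise by that of `u - f i`, since the
absolute value is not linear. Dominated convergence is used instead: summable modulars give a.e.
convergence of the whole sequence as well as an integrable majorant. -/
theorem tendsto_sobolevModular_abs_sub_abs (hq : BoundedExponent Ω q P)
    (hp : BoundedExponent (Ω ×ˢ Ω) p P) {f : ℕ → Euc n → ℝ} (hu : MemW Ω s q p u)
    (hf : ∀ i, MemW Ω s q p (f i))
    (hT : ∑' i, sobolevModular Ω s q p (fun x => u x - f i x) ≠ ∞) :
    Tendsto (fun i => sobolevModular Ω s q p (fun x => |u x| - |f i x|)) atTop (𝓝 0) := by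
  have hum := ((memW_iff hq hp).1 hu).1
  have hfm := fun i => ((memW_iff hq hp).1 (hf i)).1
  have hdm : ∀ i, AEMeasurable (fun x => |u x| - |f i x|) (volume.restrict Ω) := fun i =>
    ((memW_iff hq hp).1 ((hu.abs hq hp).sub hq hp ((hf i).abs hq hp))).1
  have hconv := ENNReal.tendsto_atTop_zero_of_tsum_ne_top hT
  have h1 : Tendsto (fun i => lebModular Ω q (fun x => |u x| - |f i x|)) atTop (𝓝 0) :=
    tendsto_of_tendsto_of_tendsto_of_le_of_le tendsto_const_nhds hconv (fun _ => zero_le)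
      fun i => (lebModular_mono hq (Eventually.of_forall fun x =>
        abs_abs_sub_abs_le _ _)).trans lebModular_le_sobolevModular
  set D : ℕ → Euc n × Euc n → ℝ := fun i => signedQuotient s p (fun x => u x - f i x)
  have hDm : ∀ i, AEMeasurable (D i) (volume.restrict (Ω ×ˢ Ω)) := fun i =>
    aemeasurable_signedQuotient hp (hum.sub (hfm i))
  have hDle : ∀ i, lebModular (Ω ×ˢ Ω) p (D i) ≤ sobolevModular Ω s q p (fun x => u x - f i x) :=
    fun i => by rw [sobolevModular_eq hp]; exact le_add_self
  have hDT : ∑' i, lebModular (Ω ×ˢ Ω) p (D i) ≠ ∞ :=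
    ne_top_of_le_ne_top hT (ENNReal.tsum_le_tsum hDle)
  have huQ : lebModular (Ω ×ˢ Ω) p (fun z => 2 * signedQuotient s p u z) ≠ ∞ := by
    refine ne_top_of_le_ne_top ?_ (lebModular_const_mul_le hp 2 (signedQuotient s p u))
    refine ENNReal.mul_ne_top ENNReal.ofReal_ne_top
      (ne_top_of_le_ne_top ((memW_iff hq hp).1 hu).2.ne ?_)
    rw [sobolevModular_eq hp]; exact le_add_self
  have h2 : Tendsto (fun i => lebModular (Ω ×ˢ Ω) p
      (signedQuotient s p (fun x => |u x| - |f i x|))) atTop (𝓝 0) := by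
    rw [← lintegral_zero (μ := volume.restrict (Ω ×ˢ Ω))]
    refine tendsto_lintegral_of_dominated_convergence'
      -- The differences of `|u|` and of `|f i|` are bounded by those of `u` and `f i`, and the
      -- latter by those of `u` and `u - f i`; hence the factor 2 on `u`. Summing over all `i` makes
      -- the bound independent of `i`.
      (fun z => ENNReal.ofReal (2 ^ P) * (ENNReal.ofReal (|2 * signedQuotient s p u z| ^ p z) +
        ∑' i, ENNReal.ofReal (|D i z| ^ p z)))
      (fun i => aemeasurable_modular_integrand hp (aemeasurable_signedQuotient hp (hdm i)))
      (fun i => ?_) ?_ ?_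
    · filter_upwards [hp.ae_one_le, hp.ae_le] with z hz1 hzP
      calc ENNReal.ofReal (|signedQuotient s p (fun x => |u x| - |f i x|) z| ^ p z)
          ≤ ENNReal.ofReal (|(|2 * signedQuotient s p u z| + |D i z|)| ^ p z) := by
            refine ENNReal.ofReal_le_ofReal (Real.rpow_le_rpow (abs_nonneg _) ?_ (by linarith))
            rw [abs_of_nonneg (show 0 ≤ |2 * signedQuotient s p u z| + |D i z| by positivity)]
            simp only [D, signedQuotient, abs_div, abs_mul, mul_div_assoc']
            rw [← add_div]
            refine div_le_div_of_nonneg_right ?_ (abs_nonneg _)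
            rw [abs_two]
            have e1 := abs_abs_sub_abs_le (u z.1) (u z.2)
            have e2 := abs_abs_sub_abs_le (f i z.1) (f i z.2)
            have e3 : |f i z.1 - f i z.2| ≤
                |u z.1 - u z.2| + |u z.1 - f i z.1 - (u z.2 - f i z.2)| := by
              refine le_trans (le_of_eq (congrArg _ ?_)) (abs_sub _ _)
              ring
            have e4 : |(|u z.1| - |f i z.1| - (|u z.2| - |f i z.2|))| ≤
                |(|u z.1| - |u z.2|)| + |(|f i z.1| - |f i z.2|)| := by
              refine le_trans (le_of_eq (congrArg _ ?_)) (abs_sub _ _)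
              ring
            linarith
        _ ≤ _ := ofReal_abs_add_rpow_le hz1 hzP _ _
        _ ≤ _ := by
          rw [abs_abs, abs_abs]
          gcongr
          exact ENNReal.le_tsum (f := fun i => ENNReal.ofReal (|D i z| ^ p z)) i
    · rw [lintegral_const_mul' _ _ ENNReal.ofReal_ne_top, lintegral_add_left'
        (aemeasurable_modular_integrand hp ((aemeasurable_signedQuotient hp hum).const_mul 2)),
        tsum_lebModular hp hDm]
      exact ENNReal.mul_ne_top ENNReal.ofReal_ne_top (ENNReal.add_ne_top.2 ⟨huQ, hDT⟩)
    · filter_upwards [hp.ae_one_le,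
        ae_prod_of_ae (ae_tendsto_of_tsum_sobolevModular hq hum hfm hT)] with z hz ht
      have e : Tendsto (fun i => signedQuotient s p (fun x => |u x| - |f i x|) z) atTop (𝓝 0) := by
        have := ((ht.1.abs.const_sub |u z.1|).sub (ht.2.abs.const_sub |u z.2|)).div_const
          (‖z.1 - z.2‖ ^ (s + n / p z))
        simpa [signedQuotient] using this
      have e2 := ENNReal.tendsto_ofReal (e.abs.rpow_const (p := p z) (Or.inr (by linarith)))
      simpa [Real.zero_rpow (show p z ≠ 0 by linarith)] using e2
  simp only [sobolevModular_eq hp]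
  simpa using h1.add h2

theorem MemWTilde.abs (hq : BoundedExponent Ω q P) (hp : BoundedExponent (Ω ×ˢ Ω) p P)
    (hu : MemWTilde Ω s q p u) : MemWTilde Ω s q p (fun x => |u x|) := by
  obtain ⟨f, hf, hfW, hfu⟩ := hu.exists_seq hq hp
  have hT : ∑' i, sobolevModular Ω s q p (fun x => u x - f i x) ≠ ∞ :=
    ne_top_of_le_ne_top tsum_inv_two_pow_ne_top (ENNReal.tsum_le_tsum fun i =>
      (sobolevModular_le_const_mul hq hp (one_le_pow₀ (by norm_num)) _).trans (hfu i))
  refine (memWTilde_iff hq hp).2 ⟨hu.1.abs hq hp, fun ε hε => ?_⟩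
  obtain ⟨i, hi⟩ := ((tendsto_sobolevModular_abs_sub_abs hq hp hu.1 hfW hT).eventually_lt_const
    (pos_iff_ne_zero.2 hε)).exists
  exact ⟨_, (hf i).comp continuous_abs abs_zero, (hfW i).abs hq hp, hi⟩

/-! ### Test functions for the capacity, and uniqueness. -/

/-- The relative capacity of a relatively open set is bounded by the modular of any admissible
function. -/
theorem relCap_le_sobolevModular {O E : Set (Euc n)} (hO : IsRelOpen Ω O) (hE : E ⊆ O)
    (hu : MemWTilde Ω s q p u) (h1 : ∀ᵐ x ∂volume.restrict Ω, x ∈ O → 1 ≤ u x) :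
    relCap Ω s q p E ≤ sobolevModular Ω s q p u :=
  iInf_le_of_le O (iInf_le_of_le hO (iInf_le_of_le hE
    (iInf_le_of_le u (iInf_le_of_le hu (iInf_le_of_le h1 le_rfl)))))

theorem exists_of_relCap_lt {O : Set (Euc n)} (hO : IsRelOpen Ω O) {ε : ℝ≥0∞}
    (h : relCap Ω s q p O < ε) : ∃ g : Euc n → ℝ, MemWTilde Ω s q p g ∧
      (∀ᵐ x ∂volume.restrict Ω, x ∈ O → 1 ≤ g x) ∧ sobolevModular Ω s q p g < ε := by
  rw [relCap_eq_relCapOpen Ω s q p hO] at h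
  simp only [relCapOpen, iInf_lt_iff] at h
  obtain ⟨g, hg, h1, h2⟩ := h
  exact ⟨g, hg, h1, h2⟩

theorem isRelPolar_setOf_ne (hq : BoundedExponent Ω q P) (hp : BoundedExponent (Ω ×ˢ Ω) p P)
    (hΩ : IsOpen Ω) (hv : IsRelQuasicontinuous Ω s q p u) (hw : IsRelQuasicontinuous Ω s q p v)
    (h : u =ᵐ[volume.restrict Ω] v) : IsRelPolar Ω s q p {x ∈ Ω | u x ≠ v x} := by
  refine ⟨fun x hx => hx.1, ?_⟩
  have key : ∀ ε : ℝ, 0 < ε → relCap Ω s q p {x ∈ Ω | u x ≠ v x} ≤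
      ENNReal.ofReal (2 ^ P) * (ENNReal.ofReal ε + ENNReal.ofReal ε) := fun ε hε => by
    obtain ⟨O₁, hO₁, hO₁Ω, hc₁, hcont₁⟩ := hv ε hε
    obtain ⟨O₂, hO₂, hO₂Ω, hc₂, hcont₂⟩ := hw ε hε
    obtain ⟨g₁, hg₁, h1₁, hlt₁⟩ := exists_of_relCap_lt hO₁ hc₁
    obtain ⟨g₂, hg₂, h1₂, hlt₂⟩ := exists_of_relCap_lt hO₂ hc₂
    have hcont : ContinuousOn (fun x => u x - v x) (Ω \ (O₁ ∪ O₂)) :=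
      (hcont₁.mono (Set.sdiff_subset_sdiff_right Set.subset_union_left)).sub
        (hcont₂.mono (Set.sdiff_subset_sdiff_right Set.subset_union_right))
    -- Continuity of the difference makes its nonzero set the trace of an open `U` off the
    -- exceptional sets.
    obtain ⟨U, hU, hUeq⟩ := continuousOn_iff'.1 hcont {0}ᶜ isOpen_compl_singleton
    obtain ⟨V₁, hV₁, rfl⟩ := hO₁
    obtain ⟨V₂, hV₂, rfl⟩ := hO₂
    have hopen : IsRelOpen Ω (closure Ω ∩ ((V₁ ∪ V₂ ∪ U) ∩ Ω)) :=
      ⟨_, ((hV₁.union hV₂).union hU).inter hΩ, rfl⟩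
    have hmem : ∀ x ∈ Ω, x ∉ closure Ω ∩ V₁ → x ∉ closure Ω ∩ V₂ → (x ∈ U ↔ u x ≠ v x) := by
      intro x hx hx1 hx2
      have := Set.ext_iff.1 hUeq x
      simp only [Set.mem_inter_iff, Set.mem_preimage, Set.mem_compl_iff, Set.mem_singleton_iff,
        sub_eq_zero] at this
      have hG : x ∈ Ω \ (closure Ω ∩ V₁ ∪ closure Ω ∩ V₂) :=
        ⟨hx, fun hh => hh.elim hx1 hx2⟩
      exact ⟨fun hxU => (this.2 ⟨hxU, hG⟩).1, fun hne => (this.1 ⟨hne, hG⟩).1⟩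
    have hsub : {x ∈ Ω | u x ≠ v x} ⊆ closure Ω ∩ ((V₁ ∪ V₂ ∪ U) ∩ Ω) := by
      rintro x ⟨hx, hne⟩
      refine ⟨subset_closure hx, ?_, hx⟩
      by_cases hx1 : x ∈ closure Ω ∩ V₁
      · exact Or.inl (Or.inl hx1.2)
      by_cases hx2 : x ∈ closure Ω ∩ V₂
      · exact Or.inl (Or.inr hx2.2)
      exact Or.inr ((hmem x hx hx1 hx2).2 hne)
    have hge : ∀ᵐ x ∂volume.restrict Ω, x ∈ closure Ω ∩ ((V₁ ∪ V₂ ∪ U) ∩ Ω) →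
        1 ≤ |g₁ x| + |g₂ x| := by
      filter_upwards [h1₁, h1₂, h] with x hx1 hx2 hxe hx
      by_cases hm1 : x ∈ closure Ω ∩ V₁
      · linarith [hx1 hm1, le_abs_self (g₁ x), abs_nonneg (g₂ x)]
      by_cases hm2 : x ∈ closure Ω ∩ V₂
      · linarith [hx2 hm2, le_abs_self (g₂ x), abs_nonneg (g₁ x)]
      rcases hx.2.1 with (hV | hV) | hV
      · exact absurd ⟨hx.1, hV⟩ hm1
      · exact absurd ⟨hx.1, hV⟩ hm2
      -- Off both exceptional sets, `U` only meets points where the functions differ, a null set.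
      · exact absurd hxe ((hmem x hx.2.2 hm1 hm2).1 hV)
    refine (relCap_le_sobolevModular hopen hsub ((hg₁.abs hq hp).add hq hp (hg₂.abs hq hp))
      hge).trans ((sobolevModular_add_le hq hp
        ((memW_iff hq hp).1 (hg₁.abs hq hp).1).1).trans ?_)
    gcongr
    · exact (sobolevModular_abs_le hq hp g₁).trans hlt₁.le
    · exact (sobolevModular_abs_le hq hp g₂).trans hlt₂.le
  have hlim : Tendsto (fun ε : ℝ => ENNReal.ofReal (2 ^ P) *
      (ENNReal.ofReal ε + ENNReal.ofReal ε)) (𝓝[>] 0) (𝓝 0) := by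
    have h0 : Tendsto (fun ε : ℝ => ENNReal.ofReal ε) (𝓝[>] 0) (𝓝 0) := by
      simpa using (ENNReal.tendsto_ofReal (tendsto_id (α := ℝ) (x := 𝓝 0))).mono_left
        nhdsWithin_le_nhds
    simpa using ENNReal.Tendsto.const_mul (h0.add h0) (Or.inr ENNReal.ofReal_ne_top)
  exact le_antisymm (ge_of_tendsto hlim (eventually_mem_nhdsWithin.mono key)) zero_le

theorem sobolevModular_congr_ae (hp : BoundedExponent (Ω ×ˢ Ω) p P)
    (h : u =ᵐ[volume.restrict Ω] v) :
    sobolevModular Ω s q p u = sobolevModular Ω s q p v := by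
  simp only [sobolevModular_eq hp]
  congr 1
  · refine lintegral_congr_ae (h.mono fun x hx => ?_)
    simp only [hx]
  · refine lintegral_congr_ae ((ae_prod_of_ae h).mono fun z hz => ?_)
    simp only [signedQuotient, hz.1, hz.2]

/-! ### Dyadic series as test functions. -/

section Series

variable {h : ℕ → Euc n → ℝ}

theorem ae_summable_dyadic (hq : BoundedExponent Ω q P)
    (hm : ∀ i, AEMeasurable (h i) (volume.restrict Ω))
    (hT : ∑' i, sobolevModular Ω s q p (h i) ≠ ∞) :
    ∀ᵐ x ∂volume.restrict Ω, Summable fun i => (1 / 2 : ℝ) ^ (i + 1) * h i x := by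
  have hT' : ∑' i, lebModular Ω q (h i) ≠ ∞ :=
    ne_top_of_le_ne_top hT (ENNReal.tsum_le_tsum fun i => lebModular_le_sobolevModular)
  filter_upwards [ae_tsum_ne_top hq hm hT', hq.ae_one_le] with x hx h1
  exact summable_dyadic_of_tsum_rpow_ne_top h1 hx

/-- Countable quasi-convexity of the modular. -/
theorem sobolevModular_tsum_le (hq : BoundedExponent Ω q P) (hp : BoundedExponent (Ω ×ˢ Ω) p P)
    (hm : ∀ i, AEMeasurable (h i) (volume.restrict Ω))
    (hT : ∑' i, sobolevModular Ω s q p (h i) ≠ ∞) :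
    sobolevModular Ω s q p (fun x => ∑' i, (1 / 2 : ℝ) ^ (i + 1) * h i x) ≤
      ∑' i, sobolevModular Ω s q p (h i) := by
  -- Summability at both points of almost every pair lets the quotient pass inside the series.
  have hs := ae_prod_of_ae (ae_summable_dyadic hq hm hT)
  simp only [sobolevModular_eq hp]
  rw [ENNReal.tsum_add]
  refine add_le_add (lebModular_tsum_le hq hm) (le_trans (le_of_eq ?_)
    (lebModular_tsum_le hp fun i => aemeasurable_signedQuotient hp (hm i)))
  refine lintegral_congr_ae (hs.mono fun z hz => ?_)
  have : signedQuotient s p (fun x => ∑' i, (1 / 2 : ℝ) ^ (i + 1) * h i x) z =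
      ∑' i, (1 / 2 : ℝ) ^ (i + 1) * signedQuotient s p (h i) z := by
    simp only [signedQuotient]
    rw [← hz.1.tsum_sub hz.2, ← tsum_div_const]
    refine tsum_congr fun i => ?_
    ring
  simp only [this]

/-- The tail is the dyadic series of `(1/2)^m * h (i + m)`, and the factor `(1/2)^m ≤ 1` can only
decrease the modular. -/
theorem sobolevModular_tsum_sub_sum_le (hq : BoundedExponent Ω q P)
    (hp : BoundedExponent (Ω ×ˢ Ω) p P) (hm : ∀ i, AEMeasurable (h i) (volume.restrict Ω))
    (hT : ∑' i, sobolevModular Ω s q p (h i) ≠ ∞) (m : ℕ) :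
    sobolevModular Ω s q p (fun x => ∑' i, (1 / 2 : ℝ) ^ (i + 1) * h i x -
      ∑ i ∈ Finset.range m, (1 / 2 : ℝ) ^ (i + 1) * h i x) ≤
      ∑' i, sobolevModular Ω s q p (h (i + m)) := by
  have hle : ∀ i, sobolevModular Ω s q p (fun x => (1 / 2 : ℝ) ^ m * h (i + m) x) ≤
      sobolevModular Ω s q p (h (i + m)) := fun i => by
    have h0 : |(1 / 2 : ℝ) ^ m| ≤ 1 := by
      rw [abs_of_nonneg (by positivity)]
      exact pow_le_one₀ (by norm_num) (by norm_num)
    refine sobolevModular_mono hq hp (fun x => ?_) fun x y => ?_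
    · rw [abs_mul]
      exact mul_le_of_le_one_left (abs_nonneg _) h0
    · rw [← mul_sub, abs_mul]
      exact mul_le_of_le_one_left (abs_nonneg _) h0
  have hT' : ∑' i, sobolevModular Ω s q p (h (i + m)) ≠ ∞ :=
    ne_top_of_le_ne_top hT (ENNReal.tsum_comp_le_tsum_of_injective (add_left_injective m)
      fun i => sobolevModular Ω s q p (h i))
  refine le_trans (le_of_eq (sobolevModular_congr_ae hp ?_))
    ((sobolevModular_tsum_le hq hp (fun i => (hm (i + m)).const_mul ((1 / 2 : ℝ) ^ m))
      (ne_top_of_le_ne_top hT' (ENNReal.tsum_le_tsum hle))).trans (ENNReal.tsum_le_tsum hle))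
  filter_upwards [ae_summable_dyadic hq hm hT] with x hx
  rw [← hx.sum_add_tsum_nat_add m, add_sub_cancel_left]
  refine tsum_congr fun i => ?_
  ring

theorem memWTilde_tsum (hq : BoundedExponent Ω q P) (hp : BoundedExponent (Ω ×ˢ Ω) p P)
    (hc : ∀ i, MemCcClosure Ω (h i)) (hW : ∀ i, MemW Ω s q p (h i))
    (hT : ∑' i, sobolevModular Ω s q p (h i) ≠ ∞) :
    MemWTilde Ω s q p (fun x => ∑' i, (1 / 2 : ℝ) ^ (i + 1) * h i x) := by
  have hm := fun i => ((memW_iff hq hp).1 (hW i)).1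
  have hzero : MemCcClosure Ω (fun _ => (0 : ℝ)) ∧ MemW Ω s q p (fun _ => (0 : ℝ)) :=
    ⟨⟨continuousOn_const, ∅, isCompact_empty, Set.empty_subset _, fun _ _ => rfl⟩,
      (memW_iff hq hp).2 ⟨aemeasurable_const, by rw [sobolevModular_zero hp hq]; simp⟩⟩
  have hpart : ∀ m, MemCcClosure Ω (fun x => ∑ i ∈ Finset.range m, (1 / 2 : ℝ) ^ (i + 1) * h i x) ∧
      MemW Ω s q p (fun x => ∑ i ∈ Finset.range m, (1 / 2 : ℝ) ^ (i + 1) * h i x) := by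
    intro m
    induction m with
    | zero => simpa using hzero
    | succ m ih =>
      simp only [Finset.sum_range_succ]
      exact ⟨ih.1.add ((hc m).comp (continuous_const_mul ((1 / 2 : ℝ) ^ (m + 1))) (mul_zero _)),
        ih.2.add hq hp ((hW m).const_mul hq hp _)⟩
  refine (memWTilde_iff hq hp).2 ⟨(memW_iff hq hp).2 ⟨?_, ?_⟩, fun ε hε => ?_⟩
  · exact AEMeasurable.tsum fun i => (hm i).const_mul _
  · exact (sobolevModular_tsum_le hq hp hm hT).trans_lt hT.lt_top
  · obtain ⟨m, hmε⟩ := ((ENNReal.tendsto_sum_nat_add _ hT).eventually_lt_const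
      (pos_iff_ne_zero.2 hε)).exists
    exact ⟨_, (hpart m).1, (hpart m).2,
      (sobolevModular_tsum_sub_sum_le hq hp hm hT m).trans_lt hmε⟩

/-- Capacity of a countable union of superlevel sets of continuous functions. -/
theorem relCap_iUnion_superlevel_le (hq : BoundedExponent Ω q P)
    (hp : BoundedExponent (Ω ×ˢ Ω) p P) (hΩ : IsOpen Ω)
    (hc : ∀ i, MemCcClosure Ω (h i)) (hW : ∀ i, MemW Ω s q p (h i)) (h0 : ∀ i x, 0 ≤ h i x)
    (hT : ∑' i, sobolevModular Ω s q p (h i) ≠ ∞) :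
    IsRelOpen Ω {x ∈ Ω | ∃ i, 2 ^ (i + 1) < h i x} ∧
      relCap Ω s q p {x ∈ Ω | ∃ i, 2 ^ (i + 1) < h i x} ≤
        ∑' i, sobolevModular Ω s q p (h i) := by
  have hm := fun i => ((memW_iff hq hp).1 (hW i)).1
  have hopen : IsRelOpen Ω {x ∈ Ω | ∃ i, 2 ^ (i + 1) < h i x} := by
    have : {x ∈ Ω | ∃ i, 2 ^ (i + 1) < h i x} = ⋃ i, Ω ∩ h i ⁻¹' Set.Ioi (2 ^ (i + 1)) := by
      ext x
      simp
    have hO : IsOpen {x ∈ Ω | ∃ i, 2 ^ (i + 1) < h i x} := by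
      rw [this]
      exact isOpen_iUnion fun i =>
        ((hc i).1.mono subset_closure).isOpen_inter_preimage hΩ isOpen_Ioi
    exact ⟨_, hO, (Set.inter_eq_right.2 fun x hx => subset_closure hx.1).symm⟩
  refine ⟨hopen, (relCap_le_sobolevModular hopen subset_rfl (memWTilde_tsum hq hp hc hW hT)
    ?_).trans (sobolevModular_tsum_le hq hp hm hT)⟩
  filter_upwards [ae_summable_dyadic hq hm hT] with x hx
  rintro ⟨-, i, hi⟩
  -- By nonnegativity the `i`-th term alone bounds the series from below; its weight cancels the
  -- threshold `2 ^ (i + 1)`.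
  refine le_trans ?_ (hx.le_tsum i fun j _ => mul_nonneg (by positivity) (h0 j x))
  calc (1 : ℝ) = (1 / 2) ^ (i + 1) * 2 ^ (i + 1) := by rw [← mul_pow]; norm_num
    _ ≤ _ := by gcongr

end Series

/-! ### Existence of the quasicontinuous representative. -/

theorem exists_quasicontinuous_representative (hq : BoundedExponent Ω q P)
    (hp : BoundedExponent (Ω ×ˢ Ω) p P) (hΩ : IsOpen Ω) (hu : MemWTilde Ω s q p u) :
    ∃ v : Euc n → ℝ, IsRelQuasicontinuous Ω s q p v ∧ v =ᵐ[volume.restrict Ω] u := by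
  obtain ⟨f, hf, hfW, hfu⟩ := hu.exists_seq hq hp
  have hum := ((memW_iff hq hp).1 hu.1).1
  have hfm := fun i => ((memW_iff hq hp).1 (hfW i)).1
  have hT : ∑' i, sobolevModular Ω s q p (fun x => u x - f i x) ≠ ∞ :=
    ne_top_of_le_ne_top tsum_inv_two_pow_ne_top (ENNReal.tsum_le_tsum fun i =>
      (sobolevModular_le_const_mul hq hp (one_le_pow₀ (by norm_num)) _).trans (hfu i))
  -- Of the factor `4^(i+1)`, one `2^(i+1)` pays for the threshold in the superlevel sets and the
  -- other gives geometric convergence off them.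
  set h : ℕ → Euc n → ℝ := fun i x => |(4 : ℝ) ^ (i + 1) * (f i x - f (i + 1) x)| with hh
  have hc : ∀ i, MemCcClosure Ω (h i) := fun i =>
    (((hf i).sub (hf (i + 1))).comp (continuous_const_mul _) (mul_zero _)).comp
      continuous_abs abs_zero
  have hW : ∀ i, MemW Ω s q p (h i) := fun i =>
    (((hfW i).sub hq hp (hfW (i + 1))).const_mul hq hp _).abs hq hp
  have hle : ∀ i, sobolevModular Ω s q p (h i) ≤
      ENNReal.ofReal (2 ^ P) * ((2⁻¹ : ℝ≥0∞) ^ i + (2⁻¹ : ℝ≥0∞) ^ (i + 1)) := fun i => by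
    refine (sobolevModular_mono hq hp
      (v := fun x => (4 : ℝ) ^ (i + 1) * (u x - f (i + 1) x) +
        -1 * ((4 : ℝ) ^ (i + 1) * (u x - f i x))) (fun x => ?_) fun x y => ?_).trans
      ((sobolevModular_add_le hq hp
        ((memW_iff hq hp).1 ((hu.1.sub hq hp (hfW (i + 1))).const_mul hq hp _)).1).trans ?_)
    · rw [hh, abs_abs]
      exact le_of_eq (congrArg _ (by ring))
    · refine (abs_abs_sub_abs_le _ _).trans (le_of_eq (congrArg _ (by ring)))
    · rw [add_comm ((2⁻¹ : ℝ≥0∞) ^ i)]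
      gcongr
      -- The approximation at index `i + 1` is controlled with `4^(i+2)`, so a factor 4 is to spare.
      · refine le_trans ?_ (hfu (i + 1))
        have := sobolevModular_le_const_mul (s := s) hq hp (c := 4) (by norm_num)
          (fun x => (4 : ℝ) ^ (i + 1) * (u x - f (i + 1) x))
        simpa only [← mul_assoc, ← pow_succ'] using this
      · refine le_trans (sobolevModular_mono hq hp (fun x => ?_) fun x y => ?_) (hfu i)
        · rw [neg_one_mul, abs_neg]
        · rw [← mul_sub, neg_one_mul, abs_neg]
  have hhT : ∑' i, sobolevModular Ω s q p (h i) ≠ ∞ := by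
    refine ne_top_of_le_ne_top ?_ (ENNReal.tsum_le_tsum hle)
    rw [ENNReal.tsum_mul_left, ENNReal.tsum_add]
    refine ENNReal.mul_ne_top ENNReal.ofReal_ne_top
      (ENNReal.add_ne_top.2 ⟨tsum_inv_two_pow_ne_top, ?_⟩)
    exact ne_top_of_le_ne_top tsum_inv_two_pow_ne_top
      (ENNReal.tsum_comp_le_tsum_of_injective (add_left_injective 1) fun i => (2⁻¹ : ℝ≥0∞) ^ i)
  -- The limit does not depend on `ε`, so one function serves every exceptional set; where the
  -- sequence diverges its value is arbitrary.
  refine ⟨fun x => limUnder atTop fun i => f i x, fun ε hε => ?_, ?_⟩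
  · obtain ⟨m, hm⟩ := ((ENNReal.tendsto_sum_nat_add _ hhT).eventually_lt_const
      (ENNReal.ofReal_pos.2 hε)).exists
    have hmT : ∑' i, sobolevModular Ω s q p (h (i + m)) ≠ ∞ := (hm.trans ENNReal.ofReal_lt_top).ne
    obtain ⟨hO, hcap⟩ := relCap_iUnion_superlevel_le hq hp hΩ (fun i => hc (i + m))
      (fun i => hW (i + m)) (fun _ _ => abs_nonneg _) hmT
    refine ⟨_, hO, fun x hx => hx.1, hcap.trans_lt hm, ?_⟩
    have hdist : ∀ x ∈ Ω \ {x ∈ Ω | ∃ i, 2 ^ (i + 1) < h (i + m) x}, ∀ i,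
        dist (f (i + m) x) (f (i + 1 + m) x) ≤ 1 / 2 / 2 ^ i := fun x hx i => by
      have h1 : h (i + m) x ≤ 2 ^ (i + 1) := not_lt.1 fun hlt => hx.2 ⟨hx.1, i, hlt⟩
      simp only [hh, abs_mul] at h1
      rw [abs_of_pos (by positivity)] at h1
      rw [Real.dist_eq, div_div, ← pow_succ', le_div_iff₀ (by positivity), add_right_comm i 1 m]
      have h2 : (4 : ℝ) ^ (i + 1) ≤ 4 ^ (i + m + 1) :=
        pow_le_pow_right₀ (by norm_num) (by omega)
      have h3 : (4 : ℝ) ^ (i + 1) = 2 ^ (i + 1) * 2 ^ (i + 1) := by rw [← mul_pow]; norm_num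
      have h4 : (2 : ℝ) ^ (i + 1) * (|f (i + m) x - f (i + m + 1) x| * 2 ^ (i + 1)) ≤
          2 ^ (i + 1) * 1 := by
        calc _ = (4 : ℝ) ^ (i + 1) * |f (i + m) x - f (i + m + 1) x| := by rw [h3]; ring
          _ ≤ 4 ^ (i + m + 1) * |f (i + m) x - f (i + m + 1) x| := by gcongr
          _ ≤ _ := by simpa using h1
      exact le_of_mul_le_mul_left h4 (by positivity)
    have hunif : TendstoUniformlyOn (fun i x => f (i + m) x)
        (fun x => limUnder atTop fun i => f i x) atTop
        (Ω \ {x ∈ Ω | ∃ i, 2 ^ (i + 1) < h (i + m) x}) := by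
      rw [Metric.tendstoUniformlyOn_iff]
      intro δ hδ
      have hlim : Tendsto (fun i : ℕ => (1 : ℝ) / 2 ^ i) atTop (𝓝 0) := by
        simpa using tendsto_pow_atTop_nhds_zero_of_lt_one (r := (1 / 2 : ℝ))
          (by norm_num) (by norm_num)
      filter_upwards [hlim.eventually_lt_const hδ] with i hi x hx
      have hcau := cauchySeq_of_le_geometric_two (hdist x hx)
      obtain ⟨a, ha⟩ := cauchySeq_tendsto_of_complete hcau
      rw [((tendsto_add_atTop_iff_nat (f := fun i => f i x) m).1 ha).limUnder_eq, dist_comm]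
      exact (dist_le_of_le_geometric_two_of_tendsto (hdist x hx) ha i).trans_lt hi
    -- A uniform limit of functions continuous on the complement of the exceptional set is
    -- continuous there.
    exact hunif.continuousOn (Frequently.of_forall fun i =>
      (hf (i + m)).1.mono fun x hx => subset_closure hx.1)
  · filter_upwards [ae_tendsto_of_tsum_sobolevModular hq hum hfm hT] with x hx
    exact hx.limUnder_eq

end Sobolev

end FracVarSobolev

theorem mainTheorem3 (n : ℕ) (Ω : Set (FracVarSobolev.Euc n)) (hΩ : IsOpen Ω)
    (s : ℝ) (hs : s ∈ Set.Ioo (0 : ℝ) 1)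
    (q : FracVarSobolev.Euc n → ℝ) (hq : FracVarSobolev.IsVarExponent Ω q)
    (p : FracVarSobolev.Euc n × FracVarSobolev.Euc n → ℝ)
    (hp : FracVarSobolev.IsVarExponent (Ω ×ˢ Ω) p)
    (u : FracVarSobolev.Euc n → ℝ) (hu : FracVarSobolev.MemWTilde Ω s q p u) :
    (∃ u' : FracVarSobolev.Euc n → ℝ,
      FracVarSobolev.IsRelQuasicontinuous Ω s q p u' ∧
        u' =ᵐ[MeasureTheory.volume.restrict Ω] u) ∧
    (∀ v w : FracVarSobolev.Euc n → ℝ,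
      FracVarSobolev.IsRelQuasicontinuous Ω s q p v →
      v =ᵐ[MeasureTheory.volume.restrict Ω] u →
      FracVarSobolev.IsRelQuasicontinuous Ω s q p w →
      w =ᵐ[MeasureTheory.volume.restrict Ω] u →
      ∃ P : Set (FracVarSobolev.Euc n), FracVarSobolev.IsRelPolar Ω s q p P ∧
        ∀ x ∈ Ω \ P, v x = w x) := by
  obtain ⟨P₁, h₁⟩ := hq.exists_boundedExponent hΩ.measurableSet
  obtain ⟨P₂, h₂⟩ := hp.exists_boundedExponent (hΩ.measurableSet.prod hΩ.measurableSet)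
  have hq' := h₁.mono (le_max_left P₁ P₂)
  have hp' := h₂.mono (le_max_right P₁ P₂)
  refine ⟨FracVarSobolev.exists_quasicontinuous_representative hq' hp' hΩ hu,
    fun v w hv hvu hw hwu => ⟨_, FracVarSobolev.isRelPolar_setOf_ne hq' hp' hΩ hv hw
      (hvu.trans hwu.symm), fun x hx => ?_⟩⟩
  by_contra hne
  exact hx.2 ⟨hx.1, hne⟩
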